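/- **Model.** A finite committee chooses between alternatives $A$ and $B$. The state is $\omega\in\{a,b\}$ with flat prior $\Pr(\omega=a)=\tfrac12$. The committee consists of $n_A$ partisans of $A$ and $n_B$ partisans of $B$, where $n_A\ge n_B$, of $n_U$ uninformed independents, and of $E$ independent experts. A partisan gets payoff $1$ if her alternative is elected and $0$ otherwise. An independent gets payoff $1$ if the outcome matches the state ($A$ in state $a$, $B$ in state $b$) and $0$ otherwise. Preferences and precisions are common knowledge. Each voter $i$ privately receives a signal $s_i\in\{a,b\}$, independently across voters given $\omega$, with $\Pr(s_i=\omega\mid\omega)=q_i$. The uninformed have $q_i=\tfrac12$, the experts have $q_i\in(\tfrac12,1]$, and the partisans have arbitrary $q_i\in[\tfrac12,1]$. Under liquid democracy a (pure) strategy of $i$ assigns to each of her two signal realizations one of the actions: vote for $A$, vote for $B$, abstain, or delegate to some voter $j\ne i$. Delegation is transitive. Votes that arrive at an abstaining voter or in a delegation cycle are not cast for either alternative. A voter who does not delegate uses all the votes she holds (her own and those delegated to her, directly or transitively) in the same way. The alternative with more votes wins, and ties are broken uniformly at random. An *equilibrium* is a Bayes Nash equilibrium in which no voter uses a weakly dominated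 strategy. A *best* equilibrium is an equilibrium that maximizes, among equilibria, the probability that the outcome is majoritarian, that is, the alternative preferred ex post by most voters. An outcome is *first-best* at a signal profile if it is an optimal choice for a single decision maker who wants the outcome to match the state and who observes the signals of all independents. Put $w^*(i)=\log\frac{q_i}{1-q_i}$, with $w^*(i)=\infty$ if $q_i=1$. **Proposition.** Fix $n_A\ge n_B$, $E$, and the experts' precisions. There is $n^*$ such that, for all precisions of the partisans, the following hold. (i) For every $n_U>n^*$, under every best equilibrium of liquid democracy the election outcome is first-best with probability $1$. (ii) There are strategy profiles $\sigma^{(n_U)}$ such that, for every $n_U>n^*$, $\sigma^{(n_U)}$ is a best equilibrium of liquid democracy (so its outcome is first-best with probability $1$) with the following properties: 1. Exactly $n_A-n_B$ uninformed independents are assigned to vote for $B$ at both signal realizations. 2. Each remaining uninformed independent either abstains at both signal realizations, or delegates to the same expert at both signal realizations. 3. Each expert $i$ holds a positive number $v_i^{(n_U)}$ of votes, which does not depend on the signal realizations. Moreover, for all experts $i,j$ that do not both have precision $1$, $$\frac{v_i^{(n_U)}}{v_j^{(n_U)}}\longrightarrow\frac{w^*(i)}{w^*(j)}\qquad (n_U\to\infty),$$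 where the limit is $\infty$ if $q_i=1>q_j$ and $0$ if $q_j=1>q_i$. -/

import Mathlib

namespace LiquidDemocracy

/-- The two labels `a`, `b`. They name the states of the world, the signal realizations
and the alternatives (alternative `A` is the one that matches state `a`, and `B` matches `b`). -/
inductive Side where
  | a : Side
  | b : Side
  deriving DecidableEq

instance : Fintype Side where
  elems := {Side.a, Side.b}
  complete x := by cases x <;> decide

/-- The other label. -/
def Side.other : Side → Side
  | .a => .b
  | .b => .a

/-- Preferences: a partisan of a fixed alternative, or an independent. -/
inductive Pref where
  | partisan (o : Side) : Pref
  | independent : Pref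
  deriving DecidableEq

/-- The alternative preferred ex post in state `ω`. -/
def Pref.favourite : Pref → Side → Side
  | .partisan o, _ => o
  | .independent, ω => ω

/-- Ex-post payoff from outcome `o` in state `ω`. -/
def Pref.utility (p : Pref) (o ω : Side) : ℝ :=
  if o = p.favourite ω then 1 else 0

/-- A committee with commonly known types: `prior` is the probability of state `a`,
and voter `i` has preference `pref i` and information precision `precision i`. -/
structure Committee (V : Type) where
  prior : ℝ
  pref : V → Pref
  precision : V → ℝ

/-- What a voter may do with her vote. -/
inductive Action (V : Type) where
  | vote (o : Side) : Action V
  | abstain : Action V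
  | delegate (j : V) : Action V

/-- Pure interim strategies of voter `i`: an action for each signal realization;
delegation to oneself is not available. -/
abbrev Strategy {V : Type} (i : V) : Type :=
  Side → {y : Action V // y ≠ Action.delegate i}

/-- Strategy profiles. -/
abbrev Profile (V : Type) : Type := (i : V) → Strategy i

section Ballot

variable {V : Type}

/-- The actions taken when the signal realizations are `s`. -/
def Profile.play (σ : Profile V) (s : V → Side) (i : V) : Action V := (σ i (s i)).1

/-- One step of (transitive) delegation: move to the delegate of `j`, or stay at `j` if `j`
does not delegate. -/
def next (α : V → Action V) (j : V) : V :=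
  match α j with
  | .delegate k => k
  | _ => j

/-- The number of votes cast for `o`: the voters whose delegation path arrives at a voter who
votes for `o`. A path that arrives at an abstainer or that enters a delegation cycle
never does so, and that vote is cast in abstention. -/
noncomputable def votesFor (α : V → Action V) (o : Side) : ℕ :=
  {j : V | ∃ n : ℕ, α ((next α)^[n] j) = Action.vote o}.ncard

/-- The number of votes held by voter `i` after all delegations: the voters (including `i`
herself) whose delegation path ends at `i`. It is `0` if `i` delegates. -/
noncomputable def votesHeld (α : V → Action V) (i : V) : ℕ :=
  {j : V | (∀ k, α i ≠ Action.delegate k) ∧ ∃ n : ℕ, (next α)^[n] j = i}.ncard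

/-- The probability that `o` is the election outcome: simple majority of the votes cast,
ties broken uniformly at random. -/
noncomputable def winProb (α : V → Action V) (o : Side) : ℝ :=
  if votesFor α o.other < votesFor α o then 1
  else if votesFor α o < votesFor α o.other then 0
  else 1 / 2

end Ballot

section Game

variable {V : Type} [Fintype V] [DecidableEq V]

/-- Prior probability of a state. -/
def Committee.priorProb (C : Committee V) : Side → ℝ
  | .a => C.prior
  | .b => 1 - C.prior

/-- Probability that voter `i` receives signal `x` in state `ω`. -/
def Committee.signalProb (C : Committee V) (i : V) (x ω : Side) : ℝ :=
  if x = ω then C.precision i else 1 - C.precision i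

/-- Expectation of `f ω s o` under the profile `σ`: the state `ω` is drawn from the prior,
the signals `s` are independent given `ω`, and the outcome `o` is decided by the election. -/
noncomputable def Committee.expect (C : Committee V) (σ : Profile V)
    (f : Side → (V → Side) → Side → ℝ) : ℝ :=
  ∑ ω : Side, C.priorProb ω * ∑ s : V → Side, (∏ i, C.signalProb i (s i) ω) *
    ∑ o : Side, winProb (σ.play s) o * f ω s o

open Classical in
/-- Probability of an event about the state, the signals and the election outcome. -/
noncomputable def Committee.prob (C : Committee V) (σ : Profile V)
    (P : Side → (V → Side) → Side → Prop) : ℝ :=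
  C.expect σ fun ω s o => if P ω s o then 1 else 0

/-- Expected utility of voter `i`. -/
noncomputable def Committee.expectedUtility (C : Committee V) (σ : Profile V) (i : V) : ℝ :=
  C.expect σ fun ω _ o => (C.pref i).utility o ω

/-- Bayes Nash equilibrium. -/
def Committee.IsBNE (C : Committee V) (σ : Profile V) : Prop :=
  ∀ (i : V) (τ : Strategy i),
    C.expectedUtility (Function.update σ i τ) i ≤ C.expectedUtility σ i

/-- The strategy `τ` of voter `i` is weakly dominated by another of her strategies. -/
def Committee.WeaklyDominated (C : Committee V) (i : V) (τ : Strategy i) : Prop :=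
  ∃ τ' : Strategy i,
    (∀ σ : Profile V, C.expectedUtility (Function.update σ i τ) i ≤
      C.expectedUtility (Function.update σ i τ') i) ∧
    ∃ σ : Profile V, C.expectedUtility (Function.update σ i τ) i <
      C.expectedUtility (Function.update σ i τ') i

/-- Equilibrium: Bayes Nash equilibrium in which no weakly dominated strategy is used. -/
def Committee.IsEquilibrium (C : Committee V) (σ : Profile V) : Prop :=
  C.IsBNE σ ∧ ∀ i, ¬ C.WeaklyDominated i (σ i)

/-- Number of voters who prefer the outcome `o` in state `ω`. -/
def Committee.supporters (C : Committee V) (ω o : Side) : ℕ :=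
  (Finset.univ.filter fun i : V => (C.pref i).favourite ω = o).card

/-- `o` is a majoritarian outcome in state `ω`: it is preferred ex post by most voters. -/
def Committee.IsMajoritarian (C : Committee V) (ω o : Side) : Prop :=
  C.supporters ω o.other ≤ C.supporters ω o

/-- Best equilibria: those that maximize the probability of the majoritarian outcome. -/
def Committee.IsBestEquilibrium (C : Committee V) (σ : Profile V) : Prop :=
  C.IsEquilibrium σ ∧ ∀ τ : Profile V, C.IsEquilibrium τ →
    C.prob τ (fun ω _ o => C.IsMajoritarian ω o) ≤ C.prob σ (fun ω _ o => C.IsMajoritarian ω o)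

/-- Joint probability of the state `ω` and of the signals in `s` of the independents. -/
def Committee.independentsJointProb (C : Committee V) (ω : Side) (s : V → Side) : ℝ :=
  C.priorProb ω *
    ∏ i ∈ Finset.univ.filter (fun i : V => C.pref i = Pref.independent), C.signalProb i (s i) ω

/-- `o` is a first-best outcome at the signals `s`: an optimal choice of a single decision maker
who wants the outcome to match the state and who sees the signals of all independents. -/
def Committee.IsFirstBest (C : Committee V) (s : V → Side) (o : Side) : Prop :=
  C.independentsJointProb o.other s ≤ C.independentsJointProb o s

/-- The election outcome is first-best with probability one. -/
def Committee.AttainsFirstBest (C : Committee V) (σ : Profile V) : Prop :=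
  C.prob σ (fun _ s o => C.IsFirstBest s o) = 1

end Game

/-- The voters: `nA` partisans of `A`, `nB` partisans of `B`, `nU` uninformed independents
and `E` experts. -/
abbrev Voter (nA nB nU E : ℕ) : Type := (Fin nA ⊕ Fin nB) ⊕ (Fin nU ⊕ Fin E)

/-- An uninformed independent as a voter. -/
abbrev uninformed {nA nB nU E : ℕ} (u : Fin nU) : Voter nA nB nU E := Sum.inr (Sum.inl u)

/-- An expert as a voter. -/
abbrev expert {nA nB nU E : ℕ} (e : Fin E) : Voter nA nB nU E := Sum.inr (Sum.inr e)

/-- The committee with flat prior, partisans with precisions `qA`, `qB`, perfectly uninformed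
independents (precision `1/2`), and independent experts with precisions `q`. -/
noncomputable def expertCommittee {nA nB E : ℕ} (nU : ℕ) (qA : Fin nA → ℝ) (qB : Fin nB → ℝ)
    (q : Fin E → ℝ) : Committee (Voter nA nB nU E) where
  prior := 1 / 2
  pref
    | .inl (.inl _) => .partisan .a
    | .inl (.inr _) => .partisan .b
    | .inr _ => .independent
  precision
    | .inl (.inl i) => qA i
    | .inl (.inr i) => qB i
    | .inr (.inl _) => 1 / 2
    | .inr (.inr e) => q e

/-- The Nitzan–Paroush weight `log (q / (1 - q))` of a precision `q ∈ [1/2, 1]`; it is infinite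
for `q = 1`. -/
noncomputable def optimalWeight (q : ℝ) : ENNReal :=
  if q = 1 then ⊤ else ENNReal.ofReal (Real.log (q / (1 - q)))

end LiquidDemocracy

/-! Once `nU > nA`, the majoritarian outcome is the one that matches the state, so best equilibria
maximize `matchProb`, which is also the common payoff of all independents. A partisan's only
undominated strategy is a constant vote (`Committee.Flat.eq_constVote`). In equilibrium the outcome
therefore depends only on the independents' signals, and `matchProb` is at most `firstBestValue`,
the value of deciding optimally at each of their signal profiles. If one equilibrium attains this
bound, every best equilibrium does, and equality signal by signal gives the first-best outcome with
probability one (`Committee.Flat.attainsFirstBest`).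

To attain it, `nA - nB` uninformed voters offset the partisans and others delegate so that experts,
voting sincerely, hold roughly `M` times their log-odds. The weighted majority then has the sign of
the log-likelihood ratio whenever that is nonzero, for all large `M`
(`eventually_weightedMajority`). At ratio zero both outcomes are optimal. A perfect expert outweighs
all imperfect ones. No independent gains by deviating, since the common payoff is already maximal.
Taking the largest `M` that fits into `nU` makes the vote ratios converge. -/

namespace LiquidDemocracy

namespace Side

@[simp] theorem other_other (x : Side) : x.other.other = x := by cases x <;> rfl

theorem other_ne (x : Side) : x.other ≠ x := by cases x <;> decide

theorem eq_or_eq_other (x y : Side) : y = x ∨ y = x.other := by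
  cases x <;> cases y <;> decide

theorem sum_eq {M : Type*} [AddCommMonoid M] (f : Side → M) (x : Side) :
    ∑ y, f y = f x + f x.other := by
  have h : (Finset.univ : Finset Side) = {x, x.other} := by cases x <;> decide
  rw [h, Finset.sum_pair (other_ne x).symm]

/-- Exchanging the two labels, as a permutation. -/
def swap : Side ≃ Side := ⟨other, other, other_other, other_other⟩

end Side

/-! ### Delegation paths and the effect of a single ballot -/

section Ballot

variable {V : Type}

theorem winProb_nonneg (α : V → Action V) (o : Side) : 0 ≤ winProb α o := by
  unfold winProb; split_ifs <;> norm_num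

theorem winProb_add_other (α : V → Action V) (o : Side) :
    winProb α o + winProb α o.other = 1 := by
  unfold winProb; rw [Side.other_other]; split_ifs <;> first | omega | norm_num

theorem winProb_le_one (α : V → Action V) (o : Side) : winProb α o ≤ 1 := by
  linarith [winProb_nonneg α o.other, winProb_add_other α o]

/-- The delegation path of `j` arrives at a voter who votes for `o`. -/
def Reaches (α : V → Action V) (o : Side) (j : V) : Prop :=
  ∃ n : ℕ, α ((next α)^[n] j) = Action.vote o

theorem next_eq_self {α : V → Action V} {j : V} {o : Side} (h : α j = .vote o) :
    next α j = j := by simp [next, h]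

theorem next_congr {α β : V → Action V} {j : V} (h : α j = β j) : next α j = next β j := by
  simp [next, h]

theorem iterate_next_of_vote {α : V → Action V} {j : V} {o : Side} (h : α j = .vote o) (n : ℕ) :
    (next α)^[n] j = j :=
  Function.iterate_fixed (next_eq_self h) n

theorem votesFor_eq_zero {α : V → Action V} {o : Side} (h : ∀ j, α j ≠ .vote o) :
    votesFor α o = 0 := by
  have : {j : V | ∃ n : ℕ, α ((next α)^[n] j) = Action.vote o} = ∅ := by
    ext j; simp [h]
  rw [votesFor, this, Set.ncard_empty]

variable [DecidableEq V]

/-- A path either avoids `i` and is unchanged, or meets `i`, where it now stops at a vote for `o`.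
-/
theorem Reaches.update_vote {α : V → Action V} {o : Side} {j : V} (i : V)
    (h : Reaches α o j) : Reaches (Function.update α i (.vote o)) o j := by
  obtain ⟨n, hn⟩ := h
  induction n generalizing j with
  | zero =>
    refine ⟨0, ?_⟩
    by_cases hj : j = i
    · subst hj; simp
    · simpa [hj] using hn
  | succ n ih =>
    by_cases hj : j = i
    · subst hj; exact ⟨0, by simp⟩
    · obtain ⟨m, hm⟩ := ih (j := next α j) hn
      refine ⟨m + 1, ?_⟩
      rw [Function.iterate_succ_apply, next_congr (β := α) (by simp [hj])]
      exact hm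

/-- After the change `i` is a fixed point voting for `o`, so a path to the other side never meets
`i` and already existed under `α`. -/
theorem Reaches.of_update_vote_other {α : V → Action V} {o : Side} {i j : V}
    (h : Reaches (Function.update α i (.vote o)) o.other j) : Reaches α o.other j := by
  obtain ⟨n, hn⟩ := h
  have hi : ∀ n, Function.update α i (.vote o)
      ((next (Function.update α i (.vote o)))^[n] i) ≠ .vote o.other := fun n => by
    rw [iterate_next_of_vote (o := o) (by simp)]
    simpa using (Side.other_ne o).symm
  induction n generalizing j with
  | zero =>
    by_cases hj : j = i
    · subst hj; exact absurd hn (hi 0)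
    · exact ⟨0, by simpa [hj] using hn⟩
  | succ n ih =>
    by_cases hj : j = i
    · subst hj; exact absurd hn (hi _)
    · obtain ⟨m, hm⟩ := ih (j := next α j) (by
        rwa [Function.iterate_succ_apply, next_congr (β := α) (by simp [hj])] at hn)
      exact ⟨m + 1, hm⟩

/-- Voting for `o` is at every signal profile the best way to bring `o` about. -/
theorem winProb_le_update_vote [Finite V] (α : V → Action V) (i : V) (o : Side) :
    winProb α o ≤ winProb (Function.update α i (.vote o)) o := by
  have h1 : votesFor α o ≤ votesFor (Function.update α i (.vote o)) o :=
    Set.ncard_le_ncard (fun j hj => Reaches.update_vote i hj) (Set.toFinite _)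
  have h2 : votesFor (Function.update α i (.vote o)) o.other ≤ votesFor α o.other :=
    Set.ncard_le_ncard (fun j hj => Reaches.of_update_vote_other hj) (Set.toFinite _)
  unfold winProb
  split_ifs <;> first | omega | norm_num

/-- Against universal abstention a single vote decides, while any other action gives `o` at most a
tie. This is the test profile for strict comparisons between strategies. -/
theorem winProb_lone_vote [Finite V] (i : V) (o : Side) :
    winProb (Function.update (fun _ => Action.abstain) i (.vote o)) o = 1 := by
  have h0 : votesFor (Function.update (fun _ : V => Action.abstain) i (.vote o)) o.other = 0 :=
    votesFor_eq_zero fun j => by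
      by_cases hj : j = i
      · subst hj; simpa using (Side.other_ne o).symm
      · simp [hj]
  have h1 : 0 < votesFor (Function.update (fun _ : V => Action.abstain) i (.vote o)) o :=
    (Set.ncard_pos (Set.toFinite _)).2 ⟨i, 0, by simp⟩
  simp [winProb, h0, h1]

theorem winProb_lone_ne_vote [Finite V] {i : V} {y : Action V} {o : Side} (hy : y ≠ .vote o) :
    winProb (Function.update (fun _ => Action.abstain) i y) o ≤ 1 / 2 := by
  have h0 : votesFor (Function.update (fun _ : V => Action.abstain) i y) o = 0 :=
    votesFor_eq_zero fun j => by
      by_cases hj : j = i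
      · subst hj; simpa using hy
      · simp [hj]
  unfold winProb
  rw [h0]
  split_ifs <;> first | omega | norm_num

theorem Profile.play_update (σ : Profile V) (i : V) (τ : Strategy i) (s : V → Side) :
    Profile.play (Function.update σ i τ) s = Function.update (σ.play s) i (τ (s i)).1 := by
  funext j
  by_cases hj : j = i
  · subst hj; simp [Profile.play]
  · simp [Profile.play, hj]

end Ballot

/-! ### Expected payoffs and weak dominance -/

section Game

variable {V : Type}

/-- Flat prior, and precisions that are probabilities. -/
structure Committee.Flat (C : Committee V) : Prop where
  prior : C.prior = 1 / 2
  nonneg : ∀ i, 0 ≤ C.precision i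
  le_one : ∀ i, C.precision i ≤ 1

variable {C : Committee V}

theorem Committee.Flat.priorProb (hC : C.Flat) (ω : Side) : C.priorProb ω = 1 / 2 := by
  cases ω
  · simp only [Committee.priorProb, hC.prior]
  · simp only [Committee.priorProb, hC.prior]; norm_num

theorem Committee.Flat.prior_sum (hC : C.Flat) : ∑ ω : Side, C.priorProb ω = 1 := by
  simp_rw [hC.priorProb, Side.sum_eq _ Side.a]
  norm_num

theorem Committee.Flat.signalProb_nonneg (hC : C.Flat) (i : V) (x ω : Side) :
    0 ≤ C.signalProb i x ω := by
  unfold Committee.signalProb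
  split_ifs
  · exact hC.nonneg i
  · linarith [hC.le_one i]

theorem Committee.sum_signalProb (C : Committee V) (i : V) (ω : Side) :
    ∑ x, C.signalProb i x ω = 1 := by
  simp [Side.sum_eq _ ω, Committee.signalProb, Side.other_ne]

theorem Committee.signalProb_other_other (C : Committee V) (i : V) (x ω : Side) :
    C.signalProb i x.other ω.other = C.signalProb i x ω := by
  cases x <;> cases ω <;> simp [Committee.signalProb, Side.other]

/-- The profile in which everybody abstains. -/
def abstention (V : Type) : Profile V := fun _ _ => ⟨.abstain, by simp⟩

/-- Voting for `p` whatever the signal. -/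
def constVote {i : V} (p : Side) : Strategy i := fun _ => ⟨.vote p, by simp⟩

/-- Voting for the alternative that the signal indicates. -/
def sincere {i : V} : Strategy i := fun x => ⟨.vote x, by simp⟩

/-- The profile in which everybody acts as if her signal had been the other one. -/
def Profile.flip (σ : Profile V) : Profile V := fun i x => σ i x.other

variable [DecidableEq V]

theorem play_update_abstention (i : V) (τ : Strategy i) (s : V → Side) :
    Profile.play (Function.update (abstention V) i τ) s =
      Function.update (fun _ => Action.abstain) i (τ (s i)).1 := by
  rw [Profile.play_update]; rfl

variable [Fintype V]

/-- The probability that the outcome matches the state. -/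
noncomputable def Committee.matchProb (C : Committee V) (σ : Profile V) : ℝ :=
  ∑ ω : Side, C.priorProb ω * ∑ s : V → Side, (∏ i, C.signalProb i (s i) ω) *
    winProb (σ.play s) ω

theorem Committee.expect_outcome_eq (C : Committee V) (σ : Profile V) (g : Side → Side) :
    C.expect σ (fun ω _ o => if o = g ω then 1 else 0) =
      ∑ ω : Side, C.priorProb ω * ∑ s : V → Side, (∏ i, C.signalProb i (s i) ω) *
        winProb (σ.play s) (g ω) := by
  simp [Committee.expect]

theorem Committee.expectedUtility_independent (C : Committee V) (σ : Profile V) {i : V}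
    (h : C.pref i = .independent) : C.expectedUtility σ i = C.matchProb σ := by
  simp only [expectedUtility, h, Pref.utility, Pref.favourite, matchProb]
  exact C.expect_outcome_eq σ id

theorem Committee.expectedUtility_partisan (C : Committee V) (σ : Profile V) {i : V} {p : Side}
    (h : C.pref i = .partisan p) : C.expectedUtility σ i =
      ∑ ω : Side, C.priorProb ω * ∑ s : V → Side, (∏ i, C.signalProb i (s i) ω) *
        winProb (σ.play s) p := by
  simp only [expectedUtility, h, Pref.utility, Pref.favourite]
  exact C.expect_outcome_eq σ fun _ => p

/-- Marginalization: `g (s i)` is a product over voters with factor one away from `i`, so the sum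
factorizes and the other voters' sums equal one. -/
theorem sum_prod_mul_eval {ι κ : Type*} [Fintype ι] [DecidableEq ι] [Fintype κ] (p : ι → κ → ℝ)
    (hp : ∀ i, ∑ x, p i x = 1) (i : ι) (g : κ → ℝ) :
    ∑ s : ι → κ, (∏ j, p j (s j)) * g (s i) = ∑ x, p i x * g x := by
  have h : ∀ s : ι → κ, (∏ j, p j (s j)) * g (s i) =
      ∏ j, p j (s j) * (if j = i then g (s j) else 1) := fun s => by
    rw [Finset.prod_mul_distrib]; simp
  simp_rw [h]
  rw [← Fintype.prod_sum (fun j x => p j x * (if j = i then g x else 1)),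
    Finset.prod_eq_single i]
  · simp
  · intro j _ hj; simp [hj, hp]
  · simp

theorem sum_prod_eq_one {ι κ : Type*} [Fintype ι] [DecidableEq ι] [Fintype κ] (p : ι → κ → ℝ)
    (hp : ∀ i, ∑ x, p i x = 1) : ∑ s : ι → κ, ∏ j, p j (s j) = 1 := by
  rw [← Fintype.prod_sum]; simp [hp]

theorem Committee.Flat.partisan_lone (hC : C.Flat) {i : V} {p : Side}
    (h : C.pref i = .partisan p) (τ : Strategy i) :
    C.expectedUtility (Function.update (abstention V) i τ) i =
      1 / 2 * ∑ x, winProb (Function.update (fun _ => Action.abstain) i (τ x).1) p := by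
  rw [C.expectedUtility_partisan _ h]
  simp_rw [play_update_abstention, hC.priorProb]
  have := fun ω => sum_prod_mul_eval (fun j x => C.signalProb j x ω)
    (fun j => C.sum_signalProb j ω) i
    (fun x => winProb (Function.update (fun _ => Action.abstain) i (τ x).1) p)
  simp_rw [this, Side.sum_eq _ Side.a]
  simp only [Committee.signalProb, Side.other]
  simp
  ring

/-- The slope `2 * C.precision i - 1` is positive for an informed voter, so following the signal is
uniquely optimal against abstention. -/
theorem Committee.Flat.independent_lone (hC : C.Flat) {i : V}
    (h : C.pref i = .independent) (τ : Strategy i) :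
    C.expectedUtility (Function.update (abstention V) i τ) i =
      1 / 2 * ∑ x, ((1 - C.precision i) + (2 * C.precision i - 1) *
        winProb (Function.update (fun _ => Action.abstain) i (τ x).1) x) := by
  rw [C.expectedUtility_independent _ h, Committee.matchProb]
  simp_rw [play_update_abstention, hC.priorProb]
  have := fun ω => sum_prod_mul_eval (fun j x => C.signalProb j x ω)
    (fun j => C.sum_signalProb j ω) i
    (fun x => winProb (Function.update (fun _ => Action.abstain) i (τ x).1) ω)
  simp_rw [this, Side.sum_eq _ Side.a]
  have e1 := winProb_add_other (Function.update (fun _ => Action.abstain) i (τ .a).1) .a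
  have e2 := winProb_add_other (Function.update (fun _ => Action.abstain) i (τ .b).1) .a
  simp only [Side.other] at e1 e2 ⊢
  rw [← eq_sub_iff_add_eq'] at e1 
  rw [← eq_sub_iff_add_eq] at e2
  simp only [Committee.signalProb, e1, e2]
  simp
  ring

theorem Committee.Flat.partisan_le_constVote (hC : C.Flat) {i : V} {p : Side}
    (h : C.pref i = .partisan p) (σ : Profile V) (τ : Strategy i) :
    C.expectedUtility (Function.update σ i τ) i ≤
      C.expectedUtility (Function.update σ i (constVote p)) i := by
  simp_rw [C.expectedUtility_partisan _ h]
  refine Finset.sum_le_sum fun ω _ => mul_le_mul_of_nonneg_left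
    (Finset.sum_le_sum fun s _ => mul_le_mul_of_nonneg_left ?_
      (Finset.prod_nonneg fun j _ => hC.signalProb_nonneg j _ _)) (by rw [hC.priorProb]; norm_num)
  have := winProb_le_update_vote (Function.update (σ.play s) i (τ (s i)).1) i p
  rw [Function.update_idem] at this
  simpa only [Profile.play_update, constVote] using this

theorem Committee.Flat.not_weaklyDominated_constVote (hC : C.Flat) {i : V} {p : Side}
    (h : C.pref i = .partisan p) : ¬ C.WeaklyDominated i (constVote p) := by
  rintro ⟨τ', -, σ, hσ⟩
  exact absurd (hC.partisan_le_constVote h σ τ') (not_le.2 hσ)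

/-- A partisan's only undominated strategy is to vote for her alternative. -/
theorem Committee.Flat.eq_constVote (hC : C.Flat) {i : V} {p : Side}
    (h : C.pref i = .partisan p) {τ : Strategy i} (hτ : ¬ C.WeaklyDominated i τ) :
    τ = constVote p := by
  by_contra hne
  refine hτ ⟨constVote p, fun σ => hC.partisan_le_constVote h σ τ, abstention V, ?_⟩
  rw [hC.partisan_lone h, hC.partisan_lone h]
  obtain ⟨x, hx⟩ : ∃ x, (τ x).1 ≠ .vote p := by
    by_contra! hall
    exact hne (funext fun x => Subtype.ext (hall x))
  rw [Side.sum_eq _ x, Side.sum_eq _ x]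
  simp only [constVote, winProb_lone_vote]
  linarith [winProb_lone_ne_vote (i := i) hx,
    winProb_le_one (Function.update (fun _ => Action.abstain) i (τ x.other).1) p]

/-- Sincere voting is undominated for an informed independent. -/
theorem Committee.Flat.not_weaklyDominated_sincere (hC : C.Flat) {i : V}
    (h : C.pref i = .independent) (hq : 1 / 2 < C.precision i) :
    ¬ C.WeaklyDominated i sincere := by
  rintro ⟨τ', hle, σ, hσ⟩
  have h1 := hle (abstention V)
  rw [hC.independent_lone h, hC.independent_lone h] at h1
  refine (lt_irrefl _) (lt_of_lt_of_eq hσ (?_ : _ = _))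
  suffices τ' = sincere by rw [this]
  by_contra hne
  obtain ⟨x, hx⟩ : ∃ x, (τ' x).1 ≠ .vote x := by
    by_contra! hall
    exact hne (funext fun x => Subtype.ext (hall x))
  rw [Side.sum_eq _ x, Side.sum_eq _ x] at h1
  simp only [sincere, winProb_lone_vote] at h1
  nlinarith [winProb_lone_ne_vote (i := i) hx,
    winProb_le_one (Function.update (fun _ => Action.abstain) i (τ' x.other).1) x.other]

theorem Committee.Flat.sum_law (hC : C.Flat) :
    ∑ ω : Side, C.priorProb ω * ∑ s : V → Side, (∏ i, C.signalProb i (s i) ω) = 1 := by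
  simp_rw [sum_prod_eq_one _ (fun j => C.sum_signalProb j _), mul_one]
  exact hC.prior_sum

/-- The law is invariant under exchanging the labels of state and signals together. Under this
exchange the flipped profile casts the original ballots in the opposite state, turning matches into
mismatches. -/
theorem Committee.Flat.matchProb_flip (hC : C.Flat) (σ : Profile V) :
    C.matchProb σ.flip = 1 - C.matchProb σ := by
  have key : C.matchProb σ.flip = ∑ ω : Side, C.priorProb ω * ∑ s : V → Side,
      (∏ i, C.signalProb i (s i) ω) * winProb (σ.play s) ω.other := by
    rw [Committee.matchProb, ← Equiv.sum_comp Side.swap]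
    simp_rw [hC.priorProb]
    refine Finset.sum_congr rfl fun ω _ => congrArg _ ?_
    rw [← Equiv.sum_comp (Equiv.arrowCongr (Equiv.refl V) Side.swap)]
    refine Finset.sum_congr rfl fun s _ => ?_
    have : σ.flip.play ((Equiv.arrowCongr (Equiv.refl V) Side.swap) s) = σ.play s := by
      funext j; simp [Profile.play, Profile.flip, Side.swap, Equiv.arrowCongr]
    rw [this]
    simp [Side.swap, Equiv.arrowCongr, C.signalProb_other_other]
  rw [eq_sub_iff_add_eq, key, Committee.matchProb, ← Finset.sum_add_distrib, ← hC.sum_law]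
  refine Finset.sum_congr rfl fun ω _ => ?_
  rw [← mul_add, ← Finset.sum_add_distrib]
  refine congrArg _ (Finset.sum_congr rfl fun s _ => ?_)
  rw [← mul_add, add_comm, winProb_add_other, mul_one]

/-- A signal of precision `1 / 2` is uniform in both states, so exchanging its realizations
preserves the law. -/
theorem Committee.matchProb_update_flip (σ : Profile V) {i : V} (hq : C.precision i = 1 / 2)
    (τ : Strategy i) : C.matchProb (Function.update σ i fun x => τ x.other) =
      C.matchProb (Function.update σ i τ) := by
  have inv : Function.Involutive fun s : V → Side => Function.update s i (s i).other := fun s => by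
    simp
  refine Finset.sum_congr rfl fun ω _ => congrArg _ ?_
  rw [← Equiv.sum_comp inv.toPerm]
  refine Finset.sum_congr rfl fun s _ => ?_
  congr 1
  · refine Finset.prod_congr rfl fun j _ => ?_
    by_cases hj : j = i
    · subst hj; simp only [Committee.signalProb, hq]; split_ifs <;> norm_num
    · simp [hj]
  · congr 1
    funext j
    by_cases hj : j = i
    · subst hj; simp [Profile.play]
    · simp [Profile.play, hj]

/-- No strategy of an uninformed independent is weakly dominated. -/
theorem Committee.Flat.not_weaklyDominated_uninformed (hC : C.Flat) {i : V}
    (h : C.pref i = .independent) (hq : C.precision i = 1 / 2) (τ : Strategy i) :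
    ¬ C.WeaklyDominated i τ := by
  rintro ⟨τ', hle, σ, hσ⟩
  simp_rw [C.expectedUtility_independent _ h] at hle hσ
  -- Flipping everybody's signal reverses the payoff ranking and flipping `i`'s own signal is
  -- immaterial, so a strict gain from `τ'` at `σ` becomes a strict loss at `σ.flip`.
  have hflip : ∀ ρ : Strategy i, C.matchProb (Function.update σ.flip i ρ) =
      1 - C.matchProb (Function.update σ i ρ) := fun ρ => by
    rw [← matchProb_update_flip σ hq, ← hC.matchProb_flip]
    congr 1
    funext j
    by_cases hj : j = i
    · subst hj; funext x; simp [Profile.flip]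
    · funext x; simp [Profile.flip, hj]
  have := hle σ.flip
  rw [hflip, hflip] at this
  linarith

end Game

/-! ### The first-best bound when the partisans ignore their signals -/

section Split

variable {P I : Type} {C : Committee (P ⊕ I)} [Fintype I]

/-- The joint probability of the state and of the signals of the second group of voters. -/
noncomputable def Committee.jointProb (C : Committee (P ⊕ I)) (ω : Side) (t : I → Side) : ℝ :=
  C.priorProb ω * ∏ i, C.signalProb (.inr i) (t i) ω

/-- Signals of the second group, completed arbitrarily in the first. -/
def extend (t : I → Side) : P ⊕ I → Side := Sum.elim (fun _ => .a) t

theorem Committee.sum_jointProb_mul_winProb_le (C : Committee (P ⊕ I))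
    (α : P ⊕ I → Action (P ⊕ I)) (t : I → Side) :
    ∑ ω, C.jointProb ω t * winProb α ω ≤ max (C.jointProb .a t) (C.jointProb .b t) := by
  rw [Side.sum_eq _ Side.a]
  have h := winProb_add_other α .a
  have ha := winProb_nonneg α .a
  have hb := winProb_nonneg α .b
  simp only [Side.other] at h ⊢
  calc _ ≤ max (C.jointProb .a t) (C.jointProb .b t) * winProb α .a +
        max (C.jointProb .a t) (C.jointProb .b t) * winProb α .b := by
        gcongr
        · exact le_max_left _ _
        · exact le_max_right _ _
    _ = _ := by rw [← mul_add, h, mul_one]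

variable [Fintype P]

theorem Committee.independentsJointProb_eq (hl : ∀ p, C.pref (.inl p) ≠ .independent)
    (hr : ∀ i, C.pref (.inr i) = .independent) (ω : Side) (s : P ⊕ I → Side) :
    C.independentsJointProb ω s = C.jointProb ω fun i => s (.inr i) := by
  rw [independentsJointProb, jointProb, Finset.prod_filter, Fintype.prod_sum_type]
  simp [hl, hr]

variable [DecidableEq P] [DecidableEq I]

/-- The first group's signals do not affect the ballots, so their probabilities sum to one and any
completion `extend t` represents them. -/
theorem Committee.expect_split (C : Committee (P ⊕ I)) {σ : Profile (P ⊕ I)}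
    (hσ : ∀ p x y, σ (.inl p) x = σ (.inl p) y)
    (g : Side → (I → Side) → Side → ℝ) :
    C.expect σ (fun ω s o => g ω (fun i => s (.inr i)) o) =
      ∑ t : I → Side, ∑ ω, C.jointProb ω t * ∑ o, winProb (σ.play (extend t)) o * g ω t o := by
  rw [Finset.sum_comm]
  refine Finset.sum_congr rfl fun ω _ => ?_
  rw [Finset.mul_sum, ← Equiv.sum_comp (Equiv.sumArrowEquivProdArrow P I Side).symm,
    Fintype.sum_prod_type_right]
  refine Finset.sum_congr rfl fun t _ => ?_
  have hplay : ∀ r : P → Side,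
      σ.play ((Equiv.sumArrowEquivProdArrow P I Side).symm (r, t)) = σ.play (extend t) := by
    intro r
    funext j
    rcases j with p | i
    · simp only [Profile.play]; rw [hσ p _ ((extend t : P ⊕ I → Side) (.inl p))]
    · rfl
  simp_rw [hplay, Fintype.prod_sum_type]
  have h1 := sum_prod_eq_one (fun (p : P) x => C.signalProb (.inl p) x ω)
    (fun p => C.sum_signalProb (.inl p) ω)
  simp only [Equiv.sumArrowEquivProdArrow_symm_apply_inl,
    Equiv.sumArrowEquivProdArrow_symm_apply_inr, Committee.jointProb]
  rw [← Finset.mul_sum, ← Finset.sum_mul, ← Finset.sum_mul, h1]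
  ring

/-- The probability with which the first-best outcome matches the state. -/
noncomputable def Committee.firstBestValue (C : Committee (P ⊕ I)) : ℝ :=
  ∑ t : I → Side, max (C.jointProb .a t) (C.jointProb .b t)

theorem Committee.matchProb_split (C : Committee (P ⊕ I)) {σ : Profile (P ⊕ I)}
    (hσ : ∀ p x y, σ (.inl p) x = σ (.inl p) y) :
    C.matchProb σ = ∑ t : I → Side, ∑ ω, C.jointProb ω t * winProb (σ.play (extend t)) ω := by
  have h1 : C.matchProb σ = C.expect σ (fun ω _ o => if o = ω then 1 else 0) :=
    (C.expect_outcome_eq σ id).symm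
  rw [h1, C.expect_split hσ (fun ω _ o => if o = ω then 1 else 0)]
  simp

theorem Committee.matchProb_le_firstBestValue (C : Committee (P ⊕ I)) {σ : Profile (P ⊕ I)}
    (hσ : ∀ p x y, σ (.inl p) x = σ (.inl p) y) : C.matchProb σ ≤ C.firstBestValue := by
  rw [C.matchProb_split hσ]
  exact Finset.sum_le_sum fun t _ => C.sum_jointProb_mul_winProb_le _ t

/-- If both alternatives can win at `t`, the hypothesis applied to each makes the joint
probabilities equal, so random tie-breaking costs nothing. -/
theorem Committee.firstBestValue_le_matchProb (C : Committee (P ⊕ I)) {σ : Profile (P ⊕ I)}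
    (hσ : ∀ p x y, σ (.inl p) x = σ (.inl p) y)
    (h : ∀ t o, 0 < winProb (σ.play (extend t)) o → C.jointProb o.other t ≤ C.jointProb o t) :
    C.firstBestValue ≤ C.matchProb σ := by
  rw [C.matchProb_split hσ]
  refine Finset.sum_le_sum fun t _ => ?_
  rw [Side.sum_eq _ Side.a]
  set α := σ.play (extend t)
  have e := winProb_add_other α .a
  have ha := (winProb_nonneg α .a).eq_or_lt
  have hb := (winProb_nonneg α .b).eq_or_lt
  simp only [Side.other] at e ⊢
  rcases ha with ha | ha
  · have := h t .b (by linarith)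
    simp only [Side.other] at this
    rw [← ha] at e ⊢
    rw [zero_add] at e
    simp [e, this]
  · have h1 := h t .a ha
    simp only [Side.other] at h1
    rw [max_eq_left h1]
    rcases hb with hb | hb
    · rw [← hb] at e ⊢
      rw [add_zero] at e
      simp [e]
    · have h2 := h t .b hb
      simp only [Side.other] at h2
      rw [le_antisymm h1 h2, ← mul_add, e, mul_one]

/-- Equality of two sums ordered termwise forces equality at every `t`. There the winning
probability of a strictly worse alternative, multiplied by the nonzero gap, vanishes. -/
theorem Committee.Flat.attainsFirstBest (hC : C.Flat) (hl : ∀ p, C.pref (.inl p) ≠ .independent)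
    (hr : ∀ i, C.pref (.inr i) = .independent) {σ : Profile (P ⊕ I)}
    (hσ : ∀ p x y, σ (.inl p) x = σ (.inl p) y) (h : C.firstBestValue ≤ C.matchProb σ) :
    C.AttainsFirstBest σ := by
  classical
  have heq := le_antisymm (C.matchProb_le_firstBestValue hσ) h
  rw [C.matchProb_split hσ, Committee.firstBestValue,
    Finset.sum_eq_sum_iff_of_le fun t _ => C.sum_jointProb_mul_winProb_le _ t] at heq
  unfold Committee.AttainsFirstBest Committee.prob
  have hfb : ∀ s o, C.IsFirstBest s o ↔
      C.jointProb o.other (fun i => s (.inr i)) ≤ C.jointProb o fun i => s (.inr i) := fun s o => by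
    rw [Committee.IsFirstBest, Committee.independentsJointProb_eq hl hr,
      Committee.independentsJointProb_eq hl hr]
  simp only [hfb]
  rw [C.expect_split hσ
    (fun _ t o => if C.jointProb o.other t ≤ C.jointProb o t then 1 else 0)]
  have hone : ∀ t : I → Side, ∑ o, winProb (σ.play (extend t)) o *
      (if C.jointProb o.other t ≤ C.jointProb o t then (1 : ℝ) else 0) = 1 := fun t => by
    have ht := heq t (Finset.mem_univ t)
    rw [Side.sum_eq _ Side.a] at ht ⊢
    have e := winProb_add_other (σ.play (extend t)) .a
    simp only [Side.other] at e ht ⊢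
    rcases lt_trichotomy (C.jointProb .a t) (C.jointProb .b t) with hlt | heq' | hlt
    · rw [max_eq_right hlt.le] at ht
      have : winProb (σ.play (extend t)) .a = 0 := by
        have : (C.jointProb .b t - C.jointProb .a t) * winProb (σ.play (extend t)) .a = 0 := by
          linear_combination C.jointProb .b t * e - ht
        exact (mul_eq_zero.1 this).resolve_left (by linarith)
      simp only [hlt.le, hlt.not_ge, if_true, if_false]
      linarith
    · simp only [heq', le_refl, if_true]
      linarith
    · rw [max_eq_left hlt.le] at ht
      have : winProb (σ.play (extend t)) .b = 0 := by
        have : (C.jointProb .a t - C.jointProb .b t) * winProb (σ.play (extend t)) .b = 0 := by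
          linear_combination C.jointProb .a t * e - ht
        exact (mul_eq_zero.1 this).resolve_left (by linarith)
      simp only [hlt.le, hlt.not_ge, if_true, if_false]
      linarith
  simp_rw [hone, mul_one]
  rw [Finset.sum_comm, ← hC.prior_sum]
  refine Finset.sum_congr rfl fun ω _ => ?_
  simp only [Committee.jointProb]
  rw [← Finset.mul_sum,
    sum_prod_eq_one (fun (i : I) x => C.signalProb (.inr i) x ω)
      (fun i => C.sum_signalProb (.inr i) ω), mul_one]

/-- A profile with dominant play by the partisans, sincere experts and first-best outcomes is
an equilibrium. -/
theorem Committee.Flat.isEquilibrium_of_firstBest (hC : C.Flat)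
    (hl : ∀ p, ∃ o, C.pref (.inl p) = .partisan o)
    (hr : ∀ i, C.pref (.inr i) = .independent) {σ : Profile (P ⊕ I)}
    (hσ : ∀ p o, C.pref (.inl p) = .partisan o → σ (.inl p) = constVote o)
    (hinf : ∀ i, C.precision (.inr i) = 1 / 2 ∨
      1 / 2 < C.precision (.inr i) ∧ σ (.inr i) = sincere)
    (h : C.firstBestValue ≤ C.matchProb σ) : C.IsEquilibrium σ := by
  refine ⟨fun i τ => ?_, fun i => ?_⟩
  · rcases i with p | i
    · obtain ⟨o, ho⟩ := hl p
      have := hC.partisan_le_constVote ho σ τ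
      rwa [← hσ p o ho, Function.update_eq_self] at this
    · rw [C.expectedUtility_independent _ (hr i), C.expectedUtility_independent _ (hr i)]
      -- A deviation by an independent leaves the partisans constant, so the common payoff stays
      -- below the bound.
      refine (C.matchProb_le_firstBestValue fun p x y => ?_).trans h
      obtain ⟨o, ho⟩ := hl p
      simp [hσ p o ho, constVote]
  · rcases i with p | i
    · obtain ⟨o, ho⟩ := hl p
      rw [hσ p o ho]
      exact hC.not_weaklyDominated_constVote ho
    · rcases hinf i with hi | ⟨hi, hs⟩
      · exact hC.not_weaklyDominated_uninformed (hr i) hi _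
      · rw [hs]
        exact hC.not_weaklyDominated_sincere (hr i) hi

theorem Committee.Flat.partisan_const_of_isEquilibrium (hC : C.Flat)
    (hl : ∀ p, ∃ o, C.pref (.inl p) = .partisan o) {σ : Profile (P ⊕ I)}
    (h : C.IsEquilibrium σ) (p : P) (x y : Side) : σ (.inl p) x = σ (.inl p) y := by
  obtain ⟨o, ho⟩ := hl p
  rw [hC.eq_constVote ho (h.2 _)]
  rfl

end Split

/-! ### Assigning roles to the uninformed and counting votes -/

section Construction

open Finset in
/-- A finite set can be labelled with prescribed numbers of labels, if there is enough room. -/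
theorem exists_labelling {R : Type*} [Fintype R] [DecidableEq R] (n : ℕ) (k : R → ℕ)
    (h : ∑ r, k r ≤ n) :
    ∃ f : Fin n → Option R, ∀ r, #{u | f u = some r} = k r := by
  classical
  -- The disjoint union of blocks of sizes `k r` embeds into `Fin n`. Points are labelled by their
  -- block, and points outside the image get `none`.
  obtain ⟨φ⟩ : Nonempty ((Σ r, Fin (k r)) ↪ Fin n) :=
    Function.Embedding.nonempty_of_card_le (by simpa using h)
  refine ⟨fun u => if hu : ∃ x, φ x = u then some hu.choose.1 else none, fun r => ?_⟩
  have hf : ∀ x, (if hu : ∃ y, φ y = φ x then some hu.choose.1 else none) = some x.1 := fun x => by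
    have hx : ∃ y, φ y = φ x := ⟨x, rfl⟩
    rw [dif_pos hx, φ.injective hx.choose_spec]
  have : ({u | (if hu : ∃ x, φ x = u then some hu.choose.1 else none) = some r} : Finset (Fin n)) =
      univ.image fun i : Fin (k r) => φ ⟨r, i⟩ := by
    ext u
    simp only [mem_filter, mem_univ, true_and, mem_image]
    constructor
    · intro hu
      by_cases hx : ∃ x, φ x = u
      · obtain ⟨⟨r', i⟩, rfl⟩ := hx
        rw [hf, Option.some_inj] at hu
        subst hu
        exact ⟨i, rfl⟩
      · rw [dif_neg hx] at hu; simp at hu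
    · rintro ⟨i, rfl⟩
      exact hf _
  rw [this, card_image_of_injective _ fun i j hij => by simpa using φ.injective hij, card_univ,
    Fintype.card_fin]

variable {nA nB nU E : ℕ}

/-- The strategy of an uninformed independent with a given role: to abstain, to vote for `B`, or
to delegate to an expert. -/
def roleStrategy (u : Fin nU) : Option (Option (Fin E)) →
    Strategy (uninformed u : Voter nA nB nU E)
  | none => fun _ => ⟨.abstain, by simp⟩
  | some none => fun _ => ⟨.vote .b, by simp⟩
  | some (some e) => fun _ => ⟨.delegate (expert e), by simp⟩

/-- Partisans vote for their alternatives, experts vote sincerely, and the uninformed play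
the roles assigned to them. -/
def roleProfile (f : Fin nU → Option (Option (Fin E))) : Profile (Voter nA nB nU E)
  | .inl (.inl _) => constVote .a
  | .inl (.inr _) => constVote .b
  | .inr (.inl u) => roleStrategy u (f u)
  | .inr (.inr _) => sincere

variable (f : Fin nU → Option (Option (Fin E))) (s : Voter nA nB nU E → Side)

theorem next_roleProfile_uninformed (u : Fin nU) :
    next ((roleProfile f).play s) (uninformed u) =
      match f u with
      | some (some e) => expert e
      | _ => uninformed u := by
  rcases h : f u with _ | _ | e <;> simp [next, Profile.play, roleProfile, roleStrategy, h]

theorem next_roleProfile_of_ne (j : Voter nA nB nU E) (hj : ∀ u : Fin nU, j ≠ uninformed u) :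
    next ((roleProfile f).play s) j = j := by
  rcases j with (i | i) | (u | e)
  · rfl
  · rfl
  · exact absurd rfl (hj u)
  · rfl

/-- Only uninformed voters delegate, and only to experts, who vote themselves: every path settles
after one step. -/
theorem next_next_roleProfile (j : Voter nA nB nU E) :
    next ((roleProfile f).play s) (next ((roleProfile f).play s) j) =
      next ((roleProfile f).play s) j := by
  by_cases hj : ∃ u : Fin nU, j = uninformed u
  · obtain ⟨u, rfl⟩ := hj
    rcases h : f u with _ | _ | e
    · simp [next_roleProfile_uninformed, h]
    · simp [next_roleProfile_uninformed, h]
    · simp [next_roleProfile_uninformed, h, next_roleProfile_of_ne]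
  · push Not at hj
    rw [next_roleProfile_of_ne f s j hj, next_roleProfile_of_ne f s j hj]

theorem iterate_next_roleProfile (j : Voter nA nB nU E) (n : ℕ) :
    (next ((roleProfile f).play s))^[n + 1] j = next ((roleProfile f).play s) j := by
  rw [Function.iterate_succ_apply, Function.iterate_fixed (next_next_roleProfile f s j)]

theorem sum_role (g : Option (Option (Fin E)) → ℕ) (h0 : g none = 0) :
    ∑ u, g (f u) = ∑ r, (Finset.univ.filter fun u => f u = some r).card * g (some r) := by
  classical
  rw [← Finset.sum_fiberwise_of_maps_to (t := Finset.univ) (g := f) (fun _ _ => Finset.mem_univ _),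
    Fintype.sum_option]
  rw [Finset.sum_eq_zero (s := {u | f u = none}) fun u hu => by
    rw [(Finset.mem_filter.1 hu).2, h0], zero_add]
  refine Finset.sum_congr rfl fun r _ => ?_
  rw [Finset.sum_congr rfl (g := fun _ => g (some r)) fun u hu => by
    rw [(Finset.mem_filter.1 hu).2], Finset.sum_const, smul_eq_mul]

/-- The number of votes that expert `e` holds. -/
def roleWeight (e : Fin E) : ℕ := (Finset.univ.filter fun u => f u = some (some e)).card + 1

theorem votesFor_roleProfile (o : Side) :
    votesFor ((roleProfile f).play s) o =
      (if o = .a then nA else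
        nB + (Finset.univ.filter fun u => f u = some none).card) +
      ∑ e, if s (expert e) = o then roleWeight f e else 0 := by
  classical
  have hset : {j | ∃ n, (roleProfile f).play s ((next ((roleProfile f).play s))^[n] j) = .vote o} =
      ((Finset.univ.filter fun j : Voter nA nB nU E =>
        (roleProfile f).play s (next ((roleProfile f).play s) j) = .vote o) :
          Set (Voter nA nB nU E)) := by
    ext j
    simp only [Set.mem_ofPred_eq, Finset.coe_filter, Finset.mem_univ, true_and]
    constructor
    · rintro ⟨_ | n, hn⟩
      · rw [Function.iterate_zero, id_eq] at hn; rwa [next_eq_self hn]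
      · rwa [iterate_next_roleProfile] at hn
    · exact fun h => ⟨1, h⟩
  rw [votesFor, hset, Set.ncard_coe_finset, Finset.card_filter, Fintype.sum_sum_type,
    Fintype.sum_sum_type, Fintype.sum_sum_type]
  -- `g` is the contribution of an uninformed voter to the count for `o`, as a function of her role.
  obtain ⟨g, h0, hb, he⟩ : ∃ g : Option (Option (Fin E)) → ℕ, g none = 0 ∧
      g (some none) = (if o = .b then 1 else 0) ∧
      ∀ e, g (some (some e)) = if s (expert e) = o then 1 else 0 :=
    ⟨fun r => r.elim 0 fun r => r.elim (if o = .b then 1 else 0)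
      fun e => if s (expert e) = o then 1 else 0, rfl, rfl, fun _ => rfl⟩
  have hu : ∀ u : Fin nU, (if (roleProfile f).play s (next ((roleProfile f).play s)
      (uninformed u : Voter nA nB nU E)) = .vote o then 1 else 0) = g (f u) := fun u => by
    rw [next_roleProfile_uninformed]
    rcases h : f u with _ | _ | e
    · simp [Profile.play, roleProfile, roleStrategy, h, h0]
    · simp [Profile.play, roleProfile, roleStrategy, h, hb, eq_comm]
    · simp [Profile.play, roleProfile, sincere, he]
  rw [Finset.sum_congr rfl fun u _ => hu u, sum_role f g h0, Fintype.sum_option, hb]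
  have hP : ∀ p, next ((roleProfile f).play s) (.inl p) = .inl p := fun p =>
    next_roleProfile_of_ne f s (.inl p) fun _ => by simp
  have hE : ∀ e : Fin E, next ((roleProfile f).play s) (expert e) = expert e := fun e =>
    next_roleProfile_of_ne f s (expert e) fun _ => by simp
  simp_rw [hP, hE, he]
  have hsum : ∑ e, (if s (expert e) = o then roleWeight f e else 0) =
      ∑ e, (Finset.univ.filter fun u => f u = some (some e)).card *
        (if s (expert e) = o then 1 else 0) + ∑ e, (if s (expert e) = o then 1 else 0) := by
    rw [← Finset.sum_add_distrib]
    refine Finset.sum_congr rfl fun e _ => ?_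
    split_ifs <;> simp [roleWeight]
  rw [hsum]
  simp only [Profile.play, roleProfile, constVote, sincere, Action.vote.injEq]
  cases o
  · simp only [if_true, reduceCtorEq, if_false, Finset.sum_const, Finset.card_univ,
      Fintype.card_fin, smul_eq_mul]
    ring
  · simp only [if_true, reduceCtorEq, if_false, Finset.sum_const, Finset.card_univ,
      Fintype.card_fin, smul_eq_mul]
    ring

theorem votesHeld_roleProfile (e : Fin E) :
    votesHeld ((roleProfile f).play s) (expert e) = roleWeight f e := by
  classical
  have hset : {j : Voter nA nB nU E | (∀ k, (roleProfile f).play s (expert e) ≠ .delegate k) ∧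
      ∃ n, (next ((roleProfile f).play s))^[n] j = expert e} =
      ((insert (expert e)
        ((Finset.univ.filter fun u => f u = some (some e)).image fun u : Fin nU => uninformed u) :
          Finset (Voter nA nB nU E)) : Set (Voter nA nB nU E)) := by
    ext j
    simp only [Set.mem_ofPred_eq, Finset.coe_insert, Finset.coe_image, Finset.coe_filter,
      Finset.mem_univ, true_and, Set.mem_insert_iff, Set.mem_image]
    constructor
    · rintro ⟨-, _ | n, hn⟩
      · exact Or.inl hn
      · rw [iterate_next_roleProfile] at hn
        by_cases hj : ∃ u : Fin nU, j = uninformed u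
        · obtain ⟨u, rfl⟩ := hj
          refine Or.inr ⟨u, ?_, rfl⟩
          rw [next_roleProfile_uninformed] at hn
          rcases h : f u with _ | _ | e'
          · simp [h] at hn
          · simp [h] at hn
          · simpa [h] using hn
        · push Not at hj
          rw [next_roleProfile_of_ne f s j hj] at hn
          exact Or.inl hn
    · intro hj
      refine ⟨fun k => by simp [Profile.play, roleProfile, sincere], ?_⟩
      rcases hj with rfl | ⟨u, hu, rfl⟩
      · exact ⟨0, rfl⟩
      · exact ⟨1, by simp [next_roleProfile_uninformed, hu]⟩
  rw [votesHeld, hset, Set.ncard_coe_finset, Finset.card_insert_of_notMem (by simp),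
    Finset.card_image_of_injective _ fun u v huv => by simpa using huv, roleWeight]

end Construction

/-! ### Integer approximation of the log-odds weights -/

section Weights

variable {E : ℕ} (q : Fin E → ℝ)

/-- The votes of the imperfect experts together, when weights are scaled by `M`. -/
noncomputable def imperfectTotal (M : ℕ) : ℕ :=
  ∑ e with q e ≠ 1, ⌈Real.log (q e / (1 - q e)) * M⌉₊

/-- Integer weights approximating `M` times the optimal weights; a perfect expert outweighs
all the imperfect ones. -/
noncomputable def approxWeight (M : ℕ) (e : Fin E) : ℕ :=
  if q e = 1 then M * (imperfectTotal q M + 1) else ⌈Real.log (q e / (1 - q e)) * M⌉₊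

variable {q} {M : ℕ}

theorem approxWeight_of_eq {e : Fin E} (h : q e = 1) :
    approxWeight q M e = M * (imperfectTotal q M + 1) := if_pos h

theorem approxWeight_of_ne {e : Fin E} (h : q e ≠ 1) :
    approxWeight q M e = ⌈Real.log (q e / (1 - q e)) * M⌉₊ := if_neg h

theorem sum_approxWeight_imperfect (q : Fin E → ℝ) (M : ℕ) :
    ∑ e with q e ≠ 1, approxWeight q M e = imperfectTotal q M :=
  Finset.sum_congr rfl fun _ he => approxWeight_of_ne (Finset.mem_filter.1 he).2

theorem approxWeight_le_imperfectTotal {e : Fin E} (h : q e ≠ 1) :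
    approxWeight q M e ≤ imperfectTotal q M := by
  rw [← sum_approxWeight_imperfect]
  exact Finset.single_le_sum (f := approxWeight q M) (fun _ _ => Nat.zero_le _) (by simp [h])

theorem log_odds_pos {p : ℝ} (h : 1 / 2 < p) (h1 : p < 1) : 0 < Real.log (p / (1 - p)) :=
  Real.log_pos ((one_lt_div (by linarith)).2 (by linarith))

theorem approxWeight_pos (hq : ∀ e, 1 / 2 < q e ∧ q e ≤ 1) (hM : 1 ≤ M) (e : Fin E) :
    0 < approxWeight q M e := by
  by_cases h : q e = 1
  · rw [approxWeight_of_eq h]; positivity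
  · rw [approxWeight_of_ne h, Nat.ceil_pos]
    exact mul_pos (log_odds_pos (hq e).1 (lt_of_le_of_ne (hq e).2 h)) (by exact_mod_cast hM)

/-- For imperfect experts, `⌈w * M⌉₊ / M` tends to `w`. The factor `M` in a perfect expert's weight
makes her ratio to an imperfect one at least `M`, and the inverse ratio at most `1 / M`. -/
theorem tendsto_approxWeight_div (hq : ∀ e, 1 / 2 < q e ∧ q e ≤ 1) {i j : Fin E}
    (hij : ¬ (q i = 1 ∧ q j = 1)) :
    Filter.Tendsto (fun M => (approxWeight q M i : ENNReal) / (approxWeight q M j : ENNReal))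
      Filter.atTop (nhds (optimalWeight (q i) / optimalWeight (q j))) := by
  by_cases hi : q i = 1
  · have hj : q j ≠ 1 := fun h => hij ⟨hi, h⟩
    rw [optimalWeight, optimalWeight, if_pos hi, if_neg hj, ENNReal.top_div_of_ne_top (by simp)]
    refine tendsto_nhds_top_mono ENNReal.tendsto_nat_nhds_top ?_
    filter_upwards [Filter.eventually_ge_atTop 1] with M hM
    have hpos := approxWeight_pos hq hM j
    rw [ENNReal.le_div_iff_mul_le (Or.inl (by exact_mod_cast hpos.ne')) (Or.inl (by simp))]
    rw [approxWeight_of_eq hi]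
    exact_mod_cast Nat.mul_le_mul_left M (Nat.le_succ_of_le (approxWeight_le_imperfectTotal hj))
  have wi := log_odds_pos (hq i).1 (lt_of_le_of_ne (hq i).2 hi)
  by_cases hj : q j = 1
  · rw [optimalWeight, optimalWeight, if_neg hi, if_pos hj, ENNReal.div_top]
    refine tendsto_of_tendsto_of_tendsto_of_le_of_le' tendsto_const_nhds
      ENNReal.tendsto_inv_nat_nhds_zero (Filter.Eventually.of_forall fun _ => zero_le) ?_
    filter_upwards [Filter.eventually_ge_atTop 1] with M hM
    refine ENNReal.div_le_of_le_mul ?_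
    rw [approxWeight_of_eq hj, Nat.cast_mul, ← mul_assoc,
      ENNReal.inv_mul_cancel (by exact_mod_cast (by omega : M ≠ 0)) (by simp), one_mul]
    exact_mod_cast Nat.le_succ_of_le (approxWeight_le_imperfectTotal hi)
  have wj := log_odds_pos (hq j).1 (lt_of_le_of_ne (hq j).2 hj)
  rw [optimalWeight, optimalWeight, if_neg hi, if_neg hj, ← ENNReal.ofReal_div_of_pos wj]
  have hlim : ∀ w : ℝ, 0 < w →
      Filter.Tendsto (fun M : ℕ => (⌈w * M⌉₊ : ℝ) / M) Filter.atTop (nhds w) := fun w hw =>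
    (tendsto_nat_ceil_mul_div_atTop hw.le).comp tendsto_natCast_atTop_atTop
  refine (ENNReal.tendsto_ofReal ((hlim _ wi).div (hlim _ wj) wj.ne')).congr' ?_
  filter_upwards [Filter.eventually_ge_atTop 1] with M hM
  have hpos := approxWeight_pos hq hM j
  have hM' : (M : ℝ) ≠ 0 := by exact_mod_cast (by omega : M ≠ 0)
  rw [approxWeight_of_ne hj] at hpos
  rw [approxWeight_of_ne hi, approxWeight_of_ne hj, Pi.div_apply, div_div_div_cancel_right₀ hM',
    ENNReal.ofReal_div_of_pos (by exact_mod_cast hpos), ENNReal.ofReal_natCast,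
    ENNReal.ofReal_natCast]

/-- For fine approximations, the weighted majority is on the side that the signals favour. -/
theorem eventually_weightedMajority (hq : ∀ e, 1 / 2 < q e ∧ q e ≤ 1) :
    ∀ᶠ M : ℕ in Filter.atTop, ∀ (t : Fin E → Side) (o : Side),
    ∏ e, (if t e = o then q e else 1 - q e) <
      ∏ e, (if t e = o.other then q e else 1 - q e) →
    ∑ e with t e = o, approxWeight q M e < ∑ e with t e = o.other, approxWeight q M e := by
  -- There are finitely many pairs `t`, `o`, so each may have its own threshold.
  simp_rw [Filter.eventually_all]
  intro t o hlt
  have h0 : ∀ e (x : Side), 0 ≤ if t e = x then q e else 1 - q e := fun e x => by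
    split_ifs
    · linarith [(hq e).1]
    · linarith [(hq e).2]
  by_cases hperf : ∃ e, q e = 1
  · obtain ⟨e₀, he₀⟩ := hperf
    have hne := ((Finset.prod_nonneg fun e _ => h0 e o).trans_lt hlt).ne'
    rw [Finset.prod_ne_zero_iff] at hne
    -- The favoured side has positive likelihood, so no perfect expert's signal contradicts it; one
    -- such expert then outweighs the entire opposition.
    have hside : ∀ e, q e = 1 → t e = o.other := fun e he => by
      by_contra hte
      exact hne e (Finset.mem_univ e) (by rw [if_neg hte, he, sub_self])
    filter_upwards [Filter.eventually_ge_atTop 1] with M hM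
    calc ∑ e with t e = o, approxWeight q M e ≤ ∑ e with q e ≠ 1, approxWeight q M e := by
          refine Finset.sum_le_sum_of_subset fun e he => ?_
          simp only [Finset.mem_filter, Finset.mem_univ, true_and] at he ⊢
          exact fun h => Side.other_ne o ((hside e h).symm.trans he)
      _ = imperfectTotal q M := sum_approxWeight_imperfect q M
      _ < M * (imperfectTotal q M + 1) := by nlinarith
      _ = approxWeight q M e₀ := (approxWeight_of_eq he₀).symm
      _ ≤ _ := Finset.single_le_sum (f := approxWeight q M) (fun _ _ => Nat.zero_le _)
          (by simp [hside e₀ he₀])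
  · push Not at hperf
    have hlt1 : ∀ e, q e < 1 := fun e => lt_of_le_of_ne (hq e).2 (hperf e)
    have hpos : ∀ e (x : Side), 0 < if t e = x then q e else 1 - q e := fun e x => by
      split_ifs
      · linarith [(hq e).1]
      · linarith [hlt1 e]
    set w : Fin E → ℝ := fun e => Real.log (q e / (1 - q e)) with hw
    have hlog := Real.log_lt_log (Finset.prod_pos fun e _ => hpos e o) hlt
    rw [Real.log_prod fun e _ => (hpos e o).ne', Real.log_prod fun e _ => (hpos e o.other).ne',
      ← sub_neg, ← Finset.sum_sub_distrib] at hlog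
    have hS : ∑ e, (if t e = o then w e else -w e) < 0 := by
      refine lt_of_eq_of_lt (Finset.sum_congr rfl fun e _ => ?_) hlog
      have hd : w e = Real.log (q e) - Real.log (1 - q e) :=
        Real.log_div (by linarith [(hq e).1]) (by linarith [hlt1 e])
      rcases Side.eq_or_eq_other o (t e) with h | h
      · simp [h, hd, (Side.other_ne o).symm]
      · simp [h, hd, Side.other_ne o]
    set S := ∑ e, (if t e = o then w e else -w e)
    -- `S` is the negative log-likelihood ratio. Rounding up costs at most one vote per expert,
    -- hence at most `E` in total, which `M * -S` exceeds.
    obtain ⟨M₀, hM₀⟩ := exists_nat_gt ((E : ℝ) / -S)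
    filter_upwards [Filter.eventually_ge_atTop M₀] with M hM
    have hMS : (E : ℝ) < M * -S := by
      rw [div_lt_iff₀ (by linarith)] at hM₀
      have : (M₀ : ℝ) ≤ M := by exact_mod_cast hM
      nlinarith
    have hbound : ∀ e, (if t e = o then (approxWeight q M e : ℝ) else 0) -
        (if t e = o.other then (approxWeight q M e : ℝ) else 0) ≤
        M * (if t e = o then w e else -w e) + 1 := fun e => by
      have hwpos := log_odds_pos (hq e).1 (hlt1 e)
      have h1 := Nat.le_ceil (w e * M)
      have h2 := (Nat.ceil_lt_add_one (mul_nonneg hwpos.le (Nat.cast_nonneg M) : 0 ≤ w e * M)).le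
      rw [approxWeight_of_ne (hperf e)]
      rcases Side.eq_or_eq_other o (t e) with h | h
      · simp only [h, (Side.other_ne o).symm, if_true, if_false]; linarith
      · simp only [h, Side.other_ne o, if_true, if_false]; linarith
    have hsum := Finset.sum_le_sum fun e (_ : e ∈ Finset.univ) => hbound e
    rw [Finset.sum_sub_distrib, Finset.sum_add_distrib, ← Finset.mul_sum] at hsum
    simp only [Finset.sum_const, Finset.card_univ, Fintype.card_fin, nsmul_eq_mul, mul_one] at hsum
    rw [← Finset.sum_filter, ← Finset.sum_filter] at hsum
    have : ((∑ e with t e = o, approxWeight q M e : ℕ) : ℝ) <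
        (∑ e with t e = o.other, approxWeight q M e : ℕ) := by
      push_cast
      linarith
    exact_mod_cast this

/-- The largest scale at which the weights can be handed out among `n` voters, `d` of whom are
reserved. -/
noncomputable def scale (q : Fin E → ℝ) (d n : ℕ) : ℕ :=
  Nat.findGreatest (fun M => ∑ e, approxWeight q M e + d ≤ n) n

theorem le_scale {d n M : ℕ} (hM : M ≤ n) (h : ∑ e, approxWeight q M e + d ≤ n) :
    M ≤ scale q d n := Nat.le_findGreatest hM h

/-- Some feasible `M` is required because `Nat.findGreatest` returns the default `0` when nothing
fits. -/
theorem scale_spec {d n M : ℕ} (hM : M ≤ n) (h : ∑ e, approxWeight q M e + d ≤ n) :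
    ∑ e, approxWeight q (scale q d n) e + d ≤ n :=
  Nat.findGreatest_spec (P := fun M => ∑ e, approxWeight q M e + d ≤ n) hM h

theorem tendsto_scale (q : Fin E → ℝ) (d : ℕ) :
    Filter.Tendsto (scale q d) Filter.atTop Filter.atTop := by
  refine Filter.tendsto_atTop.2 fun M => ?_
  filter_upwards [Filter.eventually_ge_atTop M,
    Filter.eventually_ge_atTop (∑ e, approxWeight q M e + d)] with n h1 h2
  exact le_scale h1 h2

end Weights

/-! ### The committee with experts -/

section Committee

variable {nA nB nU E : ℕ} {qA : Fin nA → ℝ} {qB : Fin nB → ℝ} {q : Fin E → ℝ}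

theorem expertCommittee_flat (hA : ∀ i, 1 / 2 ≤ qA i ∧ qA i ≤ 1)
    (hB : ∀ i, 1 / 2 ≤ qB i ∧ qB i ≤ 1) (hq : ∀ e, 1 / 2 < q e ∧ q e ≤ 1) :
    (expertCommittee nU qA qB q).Flat where
  prior := rfl
  nonneg := by
    rintro ((i | i) | (u | e)) <;> simp only [expertCommittee]
    · linarith [(hA i).1]
    · linarith [(hB i).1]
    · norm_num
    · linarith [(hq e).1]
  le_one := by
    rintro ((i | i) | (u | e)) <;> simp only [expertCommittee]
    · exact (hA i).2
    · exact (hB i).2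
    · norm_num
    · exact (hq e).2

/-- The independents alone outnumber either group of partisans, so their favourite has a strict
majority in each state. -/
theorem expertCommittee_isMajoritarian (hAB : nB ≤ nA) (hU : nA < nU) (ω o : Side) :
    (expertCommittee nU qA qB q).IsMajoritarian ω o ↔ o = ω := by
  simp_rw [Committee.IsMajoritarian, Committee.supporters, Finset.card_filter,
    Fintype.sum_sum_type]
  cases ω <;> cases o <;> simp [expertCommittee, Pref.favourite, Side.other] <;> omega

theorem expertCommittee_prob_majoritarian (hAB : nB ≤ nA) (hU : nA < nU)
    (σ : Profile (Voter nA nB nU E)) :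
    (expertCommittee nU qA qB q).prob σ
      (fun ω _ o => (expertCommittee nU qA qB q).IsMajoritarian ω o) =
      (expertCommittee nU qA qB q).matchProb σ := by
  classical
  simp only [Committee.prob, expertCommittee_isMajoritarian hAB hU]
  have h := (expertCommittee nU qA qB q).expect_outcome_eq σ id
  simp only [id] at h
  rw [Committee.matchProb, ← h]

/-- The uninformed contribute the same factor in both states, so only the experts' likelihoods
matter for comparing states. -/
theorem expertCommittee_jointProb (ω : Side) (t : Fin nU ⊕ Fin E → Side) :
    (expertCommittee nU qA qB q).jointProb ω t =
      1 / 2 * (1 / 2) ^ nU * ∏ e, (if t (.inr e) = ω then q e else 1 - q e) := by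
  have hu : ∀ u : Fin nU,
      (expertCommittee nU qA qB q).signalProb (uninformed u) (t (.inl u)) ω = 1 / 2 := fun u => by
    simp only [Committee.signalProb, expertCommittee]; split_ifs <;> norm_num
  have hp : (expertCommittee nU qA qB q).priorProb ω = 1 / 2 := by
    cases ω
    · rfl
    · simp only [Committee.priorProb, expertCommittee]; norm_num
  rw [Committee.jointProb, Fintype.prod_sum_type, hp]
  simp only [hu, Finset.prod_const, Finset.card_univ, Fintype.card_fin]
  rw [mul_assoc]
  rfl

theorem expertCommittee_pref_inl (p : Fin nA ⊕ Fin nB) :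
    ∃ o, (expertCommittee nU qA qB q).pref (.inl p) = .partisan o := by
  rcases p with i | i
  · exact ⟨.a, rfl⟩
  · exact ⟨.b, rfl⟩

theorem expertCommittee_pref_inr (i : Fin nU ⊕ Fin E) :
    (expertCommittee nU qA qB q).pref (.inr i) = .independent := rfl

theorem expertCommittee_attainsFirstBest (hC : (expertCommittee nU qA qB q).Flat)
    {σ : Profile (Voter nA nB nU E)} (hσ : (expertCommittee nU qA qB q).IsEquilibrium σ)
    (h : (expertCommittee nU qA qB q).firstBestValue ≤
      (expertCommittee nU qA qB q).matchProb σ) :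
    (expertCommittee nU qA qB q).AttainsFirstBest σ :=
  hC.attainsFirstBest (fun p => by
      obtain ⟨o, ho⟩ := expertCommittee_pref_inl (qA := qA) (qB := qB) (q := q) (nU := nU) p
      rw [ho]; simp) expertCommittee_pref_inr
    (hC.partisan_const_of_isEquilibrium expertCommittee_pref_inl hσ) h

theorem roleProfile_const (f : Fin nU → Option (Option (Fin E))) (p : Fin nA ⊕ Fin nB)
    (x y : Side) : roleProfile f (.inl p) x = roleProfile f (.inl p) y := by
  rcases p with i | i <;> rfl

theorem firstBestValue_le_matchProb_roleProfile (hAB : nB ≤ nA)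
    {f : Fin nU → Option (Option (Fin E))}
    (hf : (Finset.univ.filter fun u => f u = some none).card = nA - nB)
    (hmaj : ∀ (t : Fin E → Side) (o : Side),
      ∏ e, (if t e = o then q e else 1 - q e) <
        ∏ e, (if t e = o.other then q e else 1 - q e) →
      ∑ e with t e = o, roleWeight f e < ∑ e with t e = o.other, roleWeight f e) :
    (expertCommittee nU qA qB q).firstBestValue ≤
      (expertCommittee nU qA qB q).matchProb (roleProfile f) := by
  refine Committee.firstBestValue_le_matchProb _ (roleProfile_const f) fun t o hpos => ?_
  by_contra hlt
  rw [not_le, expertCommittee_jointProb, expertCommittee_jointProb,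
    mul_lt_mul_iff_right₀ (by positivity)] at hlt
  have hlt' := hmaj (fun e => t (.inr e)) o hlt
  refine hpos.ne' ?_
  have hvotes : votesFor ((roleProfile f).play (extend t : Voter nA nB nU E → Side)) o <
      votesFor ((roleProfile f).play (extend t : Voter nA nB nU E → Side)) o.other := by
    -- With the `nA - nB` reserved votes both sides start from `nA`, and only the experts' weights
    -- differ.
    rw [votesFor_roleProfile, votesFor_roleProfile, hf, Nat.add_sub_cancel' hAB, ite_self, ite_self]
    simp only [← Finset.sum_filter]
    exact Nat.add_lt_add_left hlt' nA
  rw [winProb, if_neg hvotes.not_gt, if_pos hvotes]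

theorem roleProfile_isEquilibrium (hC : (expertCommittee nU qA qB q).Flat)
    (hq : ∀ e, 1 / 2 < q e ∧ q e ≤ 1) {f : Fin nU → Option (Option (Fin E))}
    (h : (expertCommittee nU qA qB q).firstBestValue ≤
      (expertCommittee nU qA qB q).matchProb (roleProfile f)) :
    (expertCommittee nU qA qB q).IsEquilibrium (roleProfile f) := by
  refine hC.isEquilibrium_of_firstBest expertCommittee_pref_inl expertCommittee_pref_inr
    (fun p o ho => ?_) (fun i => ?_) h
  · rcases p with i | i <;> cases ho <;> rfl
  · rcases i with u | e
    · exact Or.inl rfl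
    · exact Or.inr ⟨(hq e).1, rfl⟩

theorem isBestEquilibrium_of_firstBest (hAB : nB ≤ nA) (hU : nA < nU)
    (hC : (expertCommittee nU qA qB q).Flat) {σ : Profile (Voter nA nB nU E)}
    (hσ : (expertCommittee nU qA qB q).IsEquilibrium σ)
    (h : (expertCommittee nU qA qB q).firstBestValue ≤
      (expertCommittee nU qA qB q).matchProb σ) :
    (expertCommittee nU qA qB q).IsBestEquilibrium σ := by
  refine ⟨hσ, fun τ hτ => ?_⟩
  rw [expertCommittee_prob_majoritarian hAB hU, expertCommittee_prob_majoritarian hAB hU]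
  exact (Committee.matchProb_le_firstBestValue _
    (hC.partisan_const_of_isEquilibrium expertCommittee_pref_inl hτ)).trans h

theorem exists_roles (hAB : nB ≤ nA) (v : Fin E → ℕ) (h : ∑ e, v e + nA ≤ nU)
    (hv : ∀ e, 0 < v e) : ∃ f : Fin nU → Option (Option (Fin E)),
      (Finset.univ.filter fun u => f u = some none).card = nA - nB ∧
      ∀ e, roleWeight f e = v e := by
  obtain ⟨f, hf⟩ := exists_labelling nU
    -- An expert already has her own vote, so `v e - 1` delegations suffice.
    (fun r : Option (Fin E) => r.elim (nA - nB) fun e => v e - 1) (by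
      rw [Fintype.sum_option]
      have : ∑ e, (v e - 1) ≤ ∑ e, v e := Finset.sum_le_sum fun e _ => Nat.sub_le _ _
      simp only [Option.elim]
      omega)
  refine ⟨f, ?_, fun e => ?_⟩
  · simpa using hf none
  · rw [roleWeight, hf (some e)]
    exact Nat.sub_add_cancel (hv e)

end Committee

end LiquidDemocracy

theorem mainTheorem6 (nA nB E : ℕ) (hAB : nB ≤ nA) (q : Fin E → ℝ)
    (hq : ∀ e, 1 / 2 < q e ∧ q e ≤ 1) :
    ∃ nStar : ℕ, ∀ (qA : Fin nA → ℝ) (qB : Fin nB → ℝ),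
      (∀ i, 1 / 2 ≤ qA i ∧ qA i ≤ 1) → (∀ i, 1 / 2 ≤ qB i ∧ qB i ≤ 1) →
      -- every best equilibrium attains the first-best outcome
      (∀ nU : ℕ, nStar < nU → ∀ σ : LiquidDemocracy.Profile (LiquidDemocracy.Voter nA nB nU E),
        (LiquidDemocracy.expertCommittee nU qA qB q).IsBestEquilibrium σ →
        (LiquidDemocracy.expertCommittee nU qA qB q).AttainsFirstBest σ) ∧
      -- best equilibria with the described structure, and their vote holdings
      ∃ (σ : (nU : ℕ) → LiquidDemocracy.Profile (LiquidDemocracy.Voter nA nB nU E))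
        (v : ℕ → Fin E → ℕ),
        (∀ nU : ℕ, nStar < nU →
          (LiquidDemocracy.expertCommittee nU qA qB q).IsBestEquilibrium (σ nU) ∧
          (LiquidDemocracy.expertCommittee nU qA qB q).AttainsFirstBest (σ nU) ∧
          (∃ S : Finset (Fin nU), S.card = nA - nB ∧
            (∀ u ∈ S, ∀ x : LiquidDemocracy.Side,
              (σ nU (LiquidDemocracy.uninformed u) x).1 = .vote .b) ∧
            (∀ u ∉ S,
              (∀ x : LiquidDemocracy.Side,
                (σ nU (LiquidDemocracy.uninformed u) x).1 = .abstain) ∨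
              (∃ e : Fin E, ∀ x : LiquidDemocracy.Side,
                (σ nU (LiquidDemocracy.uninformed u) x).1 =
                  .delegate (LiquidDemocracy.expert e)))) ∧
          (∀ e : Fin E, 0 < v nU e ∧
            ∀ s : LiquidDemocracy.Voter nA nB nU E → LiquidDemocracy.Side,
              LiquidDemocracy.votesHeld ((σ nU).play s) (LiquidDemocracy.expert e) = v nU e)) ∧
        ∀ i j : Fin E, ¬ (q i = 1 ∧ q j = 1) →
          Filter.Tendsto (fun nU : ℕ => (v nU i : ENNReal) / (v nU j : ENNReal)) Filter.atTop
            (nhds (LiquidDemocracy.optimalWeight (q i) / LiquidDemocracy.optimalWeight (q j))) := by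

  open LiquidDemocracy in
  -- From `M₀` on the weights decide correctly and, being at scale at least one, are positive. In
  -- the threshold below, `nA` leaves room for the reserved voters and makes independents a
  -- majority; `M₀` keeps this scale within the search bound. Partisan precisions play no role.
  obtain ⟨M₀, hM₀⟩ := Filter.eventually_atTop.1
    ((eventually_weightedMajority hq).and (Filter.eventually_ge_atTop 1))
  have hscale : ∀ nU, ∑ e, approxWeight q M₀ e + nA + M₀ < nU →
      M₀ ≤ scale q nA nU ∧ ∑ e, approxWeight q (scale q nA nU) e + nA ≤ nU := fun nU hU =>
    ⟨le_scale (by omega) (by omega), scale_spec (M := M₀) (by omega) (by omega)⟩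
  have hroles : ∀ nU, ∃ f : Fin nU → Option (Option (Fin E)),
      ∑ e, approxWeight q M₀ e + nA + M₀ < nU →
        (Finset.univ.filter fun u => f u = some none).card = nA - nB ∧
        ∀ e, roleWeight f e = approxWeight q (scale q nA nU) e := fun nU => by
    by_cases hU : ∑ e, approxWeight q M₀ e + nA + M₀ < nU
    · obtain ⟨f, hf⟩ := exists_roles hAB (approxWeight q (scale q nA nU)) (hscale nU hU).2
        (approxWeight_pos hq (hM₀ _ (hscale nU hU).1).2)
      exact ⟨f, fun _ => hf⟩
    · exact ⟨fun _ => none, fun h => absurd h hU⟩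
  choose f hf using hroles
  refine ⟨∑ e, approxWeight q M₀ e + nA + M₀, fun qA qB hA hB => ?_⟩
  have hC := fun nU => expertCommittee_flat (nU := nU) hA hB hq
  have hfb : ∀ nU, ∑ e, approxWeight q M₀ e + nA + M₀ < nU →
      (expertCommittee nU qA qB q).firstBestValue ≤
        (expertCommittee nU qA qB q).matchProb (roleProfile (f nU)) := fun nU hU => by
    refine firstBestValue_le_matchProb_roleProfile hAB (hf nU hU).1 ?_
    simp_rw [(hf nU hU).2]
    exact (hM₀ _ (hscale nU hU).1).1
  refine ⟨fun nU hU σ hσ => ?_, fun nU => roleProfile (f nU),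
    fun nU e => approxWeight q (scale q nA nU) e, fun nU hU => ?_, fun i j hij =>
      (tendsto_approxWeight_div hq hij).comp (tendsto_scale q nA)⟩
  · refine expertCommittee_attainsFirstBest (hC nU) hσ.1 ((hfb nU hU).trans ?_)
    -- A best equilibrium does at least as well as the constructed one, which already attains the
    -- bound.
    have := hσ.2 _ (roleProfile_isEquilibrium (hC nU) hq (hfb nU hU))
    rwa [expertCommittee_prob_majoritarian hAB (by omega),
      expertCommittee_prob_majoritarian hAB (by omega)] at this
  · have heq := roleProfile_isEquilibrium (hC nU) hq (hfb nU hU)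
    refine ⟨isBestEquilibrium_of_firstBest hAB (by omega) (hC nU) heq (hfb nU hU),
      expertCommittee_attainsFirstBest (hC nU) heq (hfb nU hU),
      ⟨Finset.univ.filter fun u => f nU u = some none, (hf nU hU).1, fun u hu x => ?_,
        fun u hu => ?_⟩,
      fun e => ⟨approxWeight_pos hq (hM₀ _ (hscale nU hU).1).2 e, fun s => ?_⟩⟩
    · simp [roleProfile, (Finset.mem_filter.1 hu).2, roleStrategy]
    · rcases h : f nU u with _ | _ | e
      · exact Or.inl fun x => by simp [roleProfile, h, roleStrategy]
      · exact absurd h (by simpa using hu)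
      · exact Or.inr ⟨e, fun x => by simp [roleProfile, h, roleStrategy]⟩
    · rw [votesHeld_roleProfile, (hf nU hU).2]
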